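/- Let $d\ge 1$, let $\Omega\subset\mathbb R^d$ be open, and let $\Omega_1,\dots,\Omega_N$ be pairwise disjoint subdomains (connected open subsets) of $\Omega$ that cover $\Omega$ up to a null set; put $I=\{1,\dots,N\}$. Let $H=H^1_0(\Omega)$ with $(v,w)_H=\int_\Omega(\nabla v\cdot\nabla w+vw)\,dx$. Let $e:H\to\mathbb R$ be of class $C^2$, and suppose that there are $M,m>0$ with $|e''(u;v,w)|\le M\|v\|_H\|w\|_H$ and $e''(u;v,v)\ge m\|v\|_H^2$ for all $u,v,w\in H$. Fix $u\in H$ and $\kappa>0$. Let $\Lambda^+=(0,\infty)^N$, where $\lambda=[\lambda_1,\dots,\lambda_N]$ is identified with the function equal to $\lambda_i$ on $\Omega_i$, and let $\partial\Lambda^+$ be the boundary of $(0,\infty)^N$ in $[0,\infty]^N$, i.e. the set of $\lambda\in[0,\infty]^N$ with at least one component equal to $0$ or $+\infty$. For $\lambda\in\Lambda^+$ let $g(\lambda)\in H$ be the unique solution of $$\int_\Omega \lambda\,\nabla g(\lambda)\cdot\nabla v+g(\lambda)v\,dx=e'(u;v)\qquad\forall v\in H,$$ and let $j(\lambda)=f(g(\lambda))$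 with $f(g)=\frac{\kappa}{2}e''(u;g,g)-e'(u;g)$. Let $(\lambda^k)$ be a minimizing sequence of $j$ in $\Lambda^+$. Then some subsequence of $(g(\lambda^k))$ converges weakly in $H^1_0(\Omega)$ and strongly in $L^2(\Omega)$ to an element $g\in H$. Moreover, whenever a subsequence of $(g(\lambda^k))$ converges weakly in $H$ to some $g$, the corresponding subsequence of $(\lambda^k)$ has a further subsequence converging componentwise in $[0,\infty]$, and for every further subsequence converging componentwise to some $\widehat\lambda\in[0,\infty]^N$ one of the following holds. (i) $\widehat\lambda\in\Lambda^+$. Then $g=g(\widehat\lambda)$, i.e. $\int_\Omega\widehat\lambda\,\nabla g\cdot\nabla v+gv\,dx=e'(u;v)$ for all $v\in H$, and $\widehat\lambda$ minimizes $j$ over $\Lambda^+$. (ii) $\widehat\lambda\in\partial\Lambda^+$. Put $I_0=\{i\in I:\widehat\lambda_i=0\}$, $I_\infty=\{i\in I:\widehat\lambda_i=+\infty\}$ (at least one of which is nonempty), $\Omega_0=\bigcup_{i\in I_0}\Omega_i$, $\Omega_\infty=\bigcup_{i\in I_\infty}\Omega_i$, and $$H^1_0(\Omega;\Omega_\infty^{\mathrm{const}})=\{v\in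 H^1_0(\Omega):\ v \text{ is a.e. equal to a constant } C_i\in\mathbb R \text{ in } \Omega_i,\ \forall i\in I_\infty\}.$$ Then $g\in H^1_0(\Omega;\Omega_\infty^{\mathrm{const}})$, and $g$ is the unique element of this space with $$\int_{\Omega\setminus\Omega_0}\widehat\lambda\,\nabla g\cdot\nabla v+gv\,dx+\int_{\Omega_0}gv\,dx=e'(u;v)\qquad\forall v\in H^1_0(\Omega;\Omega_\infty^{\mathrm{const}}),$$ where the term $\widehat\lambda\,\nabla g\cdot\nabla v$ is read as $0$ on $\Omega_\infty$ (there $\nabla g=\nabla v=0$). Furthermore, defining $g(\widehat\lambda)=g$ and $j(\widehat\lambda)=f(g)$, one has $j(\widehat\lambda)\le\liminf_{k\to\infty}j(\lambda^k)$. -/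

import Mathlib

open MeasureTheory Filter Topology Set
open scoped RealInnerProductSpace ENNReal ContDiff Gradient

noncomputable section

/-- The Euclidean space `ℝᵈ`. -/
abbrev Euc (d : ℕ) : Type := EuclideanSpace ℝ (Fin d)

/-- The Hilbert space `L²(Ω) × L²(Ω; ℝᵈ)`, with
`‖(u, G)‖² = ‖u‖²_{L²} + ‖G‖²_{L²}`. -/
abbrev L2Pair {d : ℕ} (Ω : Set (Euc d)) : Type :=
  WithLp 2 (Lp ℝ 2 (volume.restrict Ω) × Lp (Euc d) 2 (volume.restrict Ω))

/-- `φ ∈ C_c^∞(Ω)`. -/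
def IsTestFunction {d : ℕ} (Ω : Set (Euc d)) (φ : Euc d → ℝ) : Prop :=
  ContDiff ℝ ∞ φ ∧ HasCompactSupport φ ∧ tsupport φ ⊆ Ω

/-- The linear space of all pairs `(φ, ∇φ)` with `φ ∈ C_c^∞(Ω)`. -/
def testPairs {d : ℕ} (Ω : Set (Euc d)) : Submodule ℝ (L2Pair Ω) where
  carrier := {p | ∃ φ, IsTestFunction Ω φ ∧
    p.fst =ᵐ[volume.restrict Ω] φ ∧ p.snd =ᵐ[volume.restrict Ω] ∇ φ}
  zero_mem' := by
    refine ⟨fun _ => 0, ⟨contDiff_const, HasCompactSupport.zero, by simp [tsupport]⟩, ?_, ?_⟩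
    · exact Lp.coeFn_zero _ _ _
    · rw [gradient_fun_const']
      exact Lp.coeFn_zero _ _ _
  add_mem' := by
    rintro p q ⟨φ, ⟨h1, h2, h3⟩, h4, h5⟩ ⟨ψ, ⟨k1, k2, k3⟩, k4, k5⟩
    refine ⟨φ + ψ, ⟨h1.add k1, h2.add k2,
      (tsupport_add φ ψ).trans (union_subset h3 k3)⟩, ?_, ?_⟩
    · exact (Lp.coeFn_add _ _).trans (h4.add k4)
    · refine (Lp.coeFn_add _ _).trans ((h5.add k5).trans (Eventually.of_forall fun x => ?_))
      have a := (h1.differentiable (by simp)) x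
      have b := (k1.differentiable (by simp)) x
      simp only [Pi.add_apply, gradient]
      rw [fderiv_add a b, map_add]
  smul_mem' := by
    rintro c p ⟨φ, ⟨h1, h2, h3⟩, h4, h5⟩
    refine ⟨c • φ, ⟨h1.const_smul c, h2.smul_left (f := fun _ => c),
      (tsupport_smul_subset_right (fun _ => c) φ).trans h3⟩, ?_, ?_⟩
    · exact (Lp.coeFn_smul _ _).trans (h4.const_smul c)
    · refine (Lp.coeFn_smul _ _).trans ((h5.const_smul c).trans (Eventually.of_forall fun x => ?_))
      have a := (h1.differentiable (by simp)) x
      simp only [Pi.smul_apply, gradient]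
      rw [fderiv_const_smul a c]
      simp

/-- The Sobolev space `H = H¹₀(Ω)`: the closure of `C_c^∞(Ω)` in the norm
`‖v‖² = ∫_Ω |∇v|² + v²`.  An element is the pair `(v, ∇v)` of a function and its weak gradient
(the function determines the pair), and the inner product inherited from `L²(Ω) × L²(Ω; ℝᵈ)` is
`∫_Ω ∇v·∇w + v w`. -/
def H10 {d : ℕ} (Ω : Set (Euc d)) : Submodule ℝ (L2Pair Ω) :=
  (testPairs Ω).topologicalClosure

namespace H10

variable {d : ℕ} {Ω : Set (Euc d)}

instance : CompleteSpace (H10 Ω) :=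
  (Submodule.isClosed_topologicalClosure (testPairs Ω)).completeSpace_coe

/-- The function in `L²(Ω)` underlying an element of `H¹₀(Ω)`. -/
def fn (v : H10 Ω) : Lp ℝ 2 (volume.restrict Ω) := (v : L2Pair Ω).fst

/-- The weak gradient in `L²(Ω; ℝᵈ)` of an element of `H¹₀(Ω)`. -/
def grad (v : H10 Ω) : Lp (Euc d) 2 (volume.restrict Ω) := (v : L2Pair Ω).snd

theorem inner_eq (v w : H10 Ω) : ⟪v, w⟫ = ⟪(H10.fn v), (H10.fn w)⟫ + ⟪(H10.grad v), (H10.grad w)⟫ := rfl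

theorem inner_eq_integral (v w : H10 Ω) :
    ⟪v, w⟫ = ∫ x in Ω, ⟪(H10.grad v) x, (H10.grad w) x⟫ + (H10.fn v) x * (H10.fn w) x := by
  rw [inner_eq, L2.inner_def, L2.inner_def, add_comm,
    ← integral_add (L2.integrable_inner _ _) (L2.integrable_inner _ _)]
  refine integral_congr_ae (Eventually.of_forall fun x => ?_)
  simp [mul_comm]

/-- `grad v` is the weak gradient of `fn v`. -/
theorem weak_gradient (v : H10 Ω) {φ : Euc d → ℝ} (hφ : IsTestFunction Ω φ) (y : Euc d) :
    ∫ x in Ω, (H10.fn v) x * fderiv ℝ φ x y = - ∫ x in Ω, ⟪(H10.grad v) x, y⟫ * φ x := by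
  obtain ⟨h1, h2, h3⟩ := hφ
  have hc' : Continuous fun x => fderiv ℝ φ x y :=
    (h1.continuous_fderiv (by simp)).clm_apply continuous_const
  have hs' : HasCompactSupport fun x => fderiv ℝ φ x y := h2.fderiv_apply ℝ y
  have m1 : MemLp (fun x => fderiv ℝ φ x y) 2 (volume.restrict Ω) :=
    (hc'.memLp_of_hasCompactSupport hs').restrict Ω
  have m2 : MemLp (fun x => φ x • y) 2 (volume.restrict Ω) :=
    ((h1.continuous.smul continuous_const).memLp_of_hasCompactSupport
      (h2.smul_right (f' := fun _ => y))).restrict Ω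
  have e1 : ∀ p : L2Pair Ω, ∫ x in Ω, p.fst x * fderiv ℝ φ x y = ⟪p.fst, m1.toLp⟫ := by
    intro p
    rw [L2.inner_def]
    refine integral_congr_ae ?_
    filter_upwards [m1.coeFn_toLp] with x hx
    simp [hx, mul_comm]
  have e2 : ∀ p : L2Pair Ω, ∫ x in Ω, ⟪p.snd x, y⟫ * φ x = ⟪p.snd, m2.toLp⟫ := by
    intro p
    rw [L2.inner_def]
    refine integral_congr_ae ?_
    filter_upwards [m2.coeFn_toLp] with x hx
    rw [hx, real_inner_smul_right, mul_comm]
  suffices H : ∀ p : L2Pair Ω, p ∈ H10 Ω →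
      ⟪p.fst, m1.toLp⟫ = - ⟪p.snd, m2.toLp⟫ by
    have := H v v.2
    rw [← e1, ← e2] at this
    exact this
  intro p hp
  have hcl : IsClosed {p : L2Pair Ω | ⟪p.fst, m1.toLp⟫ = - ⟪p.snd, m2.toLp⟫} :=
    isClosed_eq (by fun_prop) (by fun_prop)
  refine closure_minimal (s := (testPairs Ω : Set (L2Pair Ω))) ?_ hcl hp
  rintro q ⟨ψ, ⟨k1, k2, k3⟩, k4, k5⟩
  change ⟪q.fst, m1.toLp⟫ = - ⟪q.snd, m2.toLp⟫
  rw [← e1, ← e2]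
  have a1 : ∫ x in Ω, q.fst x * fderiv ℝ φ x y = ∫ x in Ω, ψ x * fderiv ℝ φ x y := by
    refine integral_congr_ae ?_
    filter_upwards [k4] with x hx
    rw [hx]
  have a2 : ∫ x in Ω, ⟪q.snd x, y⟫ * φ x = ∫ x in Ω, fderiv ℝ ψ x y * φ x := by
    refine integral_congr_ae ?_
    filter_upwards [k5] with x hx
    rw [hx, inner_gradient_left]
  have z : ∀ x, x ∉ Ω → ψ x = 0 := fun x hx => image_eq_zero_of_notMem_tsupport fun h => hx (k3 h)
  have z' : ∀ x, x ∉ Ω → φ x = 0 := fun x hx => image_eq_zero_of_notMem_tsupport fun h => hx (h3 h)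
  have dc' : Continuous fun x => fderiv ℝ ψ x y :=
    (k1.continuous_fderiv (by simp)).clm_apply continuous_const
  rw [a1, a2, setIntegral_eq_integral_of_forall_compl_eq_zero (fun x hx => by simp [z x hx]),
    setIntegral_eq_integral_of_forall_compl_eq_zero (fun x hx => by simp [z' x hx])]
  exact integral_mul_fderiv_eq_neg_fderiv_mul_of_integrable
    ((dc'.mul h1.continuous).integrable_of_hasCompactSupport h2.mul_left)
    ((k1.continuous.mul hc').integrable_of_hasCompactSupport hs'.mul_left)
    ((k1.continuous.mul h1.continuous).integrable_of_hasCompactSupport h2.mul_left)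
    (fun x _ => h1.differentiable (by simp) x |> fun _ => k1.differentiable (by simp) x)
    (fun x _ => h1.differentiable (by simp) x)

end H10

/-- `Ω₁, …, Ω_N` is a partition of `Ω` (up to a null set) into pairwise disjoint
subdomains (connected open sets). -/
structure IsDomainPartition {d N : ℕ} (Ω : Set (Euc d)) (P : Fin N → Set (Euc d)) : Prop where
  isOpen : ∀ i, IsOpen (P i)
  isConnected : ∀ i, IsConnected (P i)
  subset : ∀ i, P i ⊆ Ω
  disjoint : Pairwise fun i j => Disjoint (P i) (P j)
  null : volume (Ω \ ⋃ i, P i) = 0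

/-- The piecewise constant function with value `lam i` on `Ω_i`. -/
def weight {d N : ℕ} (P : Fin N → Set (Euc d)) (lam : Fin N → ℝ) (x : Euc d) : ℝ :=
  ∑ i, (P i).indicator (fun _ => lam i) x

/-- `Λ⁺`, in the coordinates `λ = [λ₁, …, λ_N]`. -/
def LamPlus (N : ℕ) : Set (Fin N → ℝ) := {lam | ∀ i, 0 < lam i}

/-- `∂Λ⁺`, the boundary of `Λ⁺ = (0, ∞)^N` in `[0, ∞]^N`. -/
def LamBoundary (N : ℕ) : Set (Fin N → ℝ≥0∞) := {lam | ∃ i, lam i = 0 ∨ lam i = ⊤}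

/-- The form `(v, w)_λ = ∫_Ω λ ∇v·∇w + v w`. -/
def innerLam {d N : ℕ} {Ω : Set (Euc d)} (P : Fin N → Set (Euc d)) (lam : Fin N → ℝ)
    (v w : H10 Ω) : ℝ :=
  ∫ x in Ω, weight P lam x * ⟪(H10.grad v) x, (H10.grad w) x⟫ + (H10.fn v) x * (H10.fn w) x

/-- The gradient `g(λ)` at `u` of the energy `e`: the solution `g ∈ H` of
`(g, v)_λ = e'(u; v)` for all `v ∈ H`.  For `λ ∈ Λ⁺` it exists and is unique. -/
def gradLam {d N : ℕ} {Ω : Set (Euc d)} (P : Fin N → Set (Euc d)) (e : H10 Ω → ℝ) (u : H10 Ω)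
    (lam : Fin N → ℝ) : H10 Ω :=
  Classical.epsilon fun g => ∀ v, innerLam P lam g v = fderiv ℝ e u v

section existence

variable {d N : ℕ} {Ω : Set (Euc d)} {P : Fin N → Set (Euc d)}

theorem weight_measurable (hP : IsDomainPartition Ω P) (lam : Fin N → ℝ) :
    Measurable (weight P lam) :=
  Finset.measurable_fun_sum _ fun i _ => measurable_const.indicator (hP.isOpen i).measurableSet

theorem weight_eq (hP : IsDomainPartition Ω P) (lam : Fin N → ℝ) {i : Fin N} {x : Euc d}
    (hx : x ∈ P i) : weight P lam x = lam i := by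
  rw [weight, Finset.sum_eq_single i]
  · simp [hx]
  · intro j _ hj
    exact indicator_of_notMem (fun h => disjoint_left.1 (hP.disjoint hj) h hx) _
  · simp

theorem weight_abs_le (P : Fin N → Set (Euc d)) (lam : Fin N → ℝ) (x : Euc d) :
    |weight P lam x| ≤ ∑ i, |lam i| := by
  refine (Finset.abs_sum_le_sum_abs _ _).trans (Finset.sum_le_sum fun i _ => ?_)
  by_cases h : x ∈ P i <;> simp [h]

theorem ae_mem_part (hΩ : IsOpen Ω) (hP : IsDomainPartition Ω P) :
    ∀ᵐ x ∂(volume.restrict Ω), ∃ i, x ∈ P i := by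
  rw [ae_restrict_iff' hΩ.measurableSet, ae_iff]
  convert hP.null using 2
  ext x
  simp

theorem weight_integrable (hP : IsDomainPartition Ω P) (lam : Fin N → ℝ) (v w : H10 Ω) :
    Integrable (fun x => weight P lam x * ⟪(H10.grad v) x, (H10.grad w) x⟫) (volume.restrict Ω) :=
  (L2.integrable_inner (H10.grad v) (H10.grad w)).bdd_mul (c := ∑ i, |lam i|)
    (weight_measurable hP lam).aestronglyMeasurable
    (Eventually.of_forall fun x => by simpa using weight_abs_le P lam x)

theorem fn_integrable (v w : H10 Ω) :
    Integrable (fun x => (H10.fn v) x * (H10.fn w) x) (volume.restrict Ω) :=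
  (L2.integrable_inner (𝕜 := ℝ) (H10.fn v) (H10.fn w)).congr
    (Eventually.of_forall fun x => by simp [mul_comm])

theorem innerLam_integrable (hP : IsDomainPartition Ω P) (lam : Fin N → ℝ) (v w : H10 Ω) :
    Integrable (fun x => weight P lam x * ⟪(H10.grad v) x, (H10.grad w) x⟫ + (H10.fn v) x * (H10.fn w) x)
      (volume.restrict Ω) :=
  (weight_integrable hP lam v w).add (fn_integrable v w)

theorem innerLam_comm (lam : Fin N → ℝ) (v w : H10 Ω) :
    innerLam P lam v w = innerLam P lam w v := by
  refine integral_congr_ae (Eventually.of_forall fun x => ?_)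
  simp only [real_inner_comm, mul_comm]

theorem innerLam_add (hP : IsDomainPartition Ω P) (lam : Fin N → ℝ) (v v' w : H10 Ω) :
    innerLam P lam (v + v') w = innerLam P lam v w + innerLam P lam v' w := by
  rw [innerLam, innerLam, innerLam,
    ← integral_add (innerLam_integrable hP lam v w) (innerLam_integrable hP lam v' w)]
  refine integral_congr_ae ?_
  filter_upwards [Lp.coeFn_add (H10.fn v) (H10.fn v'), Lp.coeFn_add (H10.grad v) (H10.grad v')] with x h1 h2
  have h1' : (H10.fn (v + v')) x = (H10.fn v) x + (H10.fn v') x := h1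
  have h2' : (H10.grad (v + v')) x = (H10.grad v) x + (H10.grad v') x := h2
  rw [h1', h2', inner_add_left]
  ring

theorem innerLam_smul (lam : Fin N → ℝ) (c : ℝ) (v w : H10 Ω) :
    innerLam P lam (c • v) w = c * innerLam P lam v w := by
  rw [innerLam, innerLam, ← integral_const_mul]
  refine integral_congr_ae ?_
  filter_upwards [Lp.coeFn_smul c (H10.fn v), Lp.coeFn_smul c (H10.grad v)] with x h1 h2
  have h1' : (H10.fn (c • v)) x = c * (H10.fn v) x := h1
  have h2' : (H10.grad (c • v)) x = c • (H10.grad v) x := h2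
  rw [h1', h2', real_inner_smul_left]
  ring

theorem sq_norm_eq (v : H10 Ω) :
    ‖v‖ ^ 2 = ∫ x in Ω, ‖(H10.grad v) x‖ ^ 2 + (H10.fn v) x * (H10.fn v) x := by
  rw [← real_inner_self_eq_norm_sq, H10.inner_eq_integral]
  simp only [real_inner_self_eq_norm_sq]

theorem innerLam_coercive (hΩ : IsOpen Ω) (hP : IsDomainPartition Ω P) {lam : Fin N → ℝ}
    (hlam : lam ∈ LamPlus N) : ∃ c > 0, ∀ v : H10 Ω, c * ‖v‖ ^ 2 ≤ innerLam P lam v v := by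
  obtain ⟨c, hc0, hc1, hc⟩ : ∃ c : ℝ, 0 < c ∧ c ≤ 1 ∧ ∀ i, c ≤ lam i := by
    rcases isEmpty_or_nonempty (Fin N) with h | h
    · exact ⟨1, one_pos, le_rfl, fun i => h.elim i⟩
    · obtain ⟨i, hi⟩ := Finite.exists_min lam
      exact ⟨min 1 (lam i), lt_min one_pos (hlam i), min_le_left _ _,
        fun j => (min_le_right _ _).trans (hi j)⟩
  refine ⟨c, hc0, fun v => ?_⟩
  rw [sq_norm_eq, ← integral_const_mul, innerLam]
  have hi := innerLam_integrable hP (fun _ => 1) v v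
  refine integral_mono_ae ?_ (innerLam_integrable hP lam v v) ?_
  · refine Integrable.const_mul (hi.congr ?_) c
    filter_upwards [ae_mem_part hΩ hP] with x ⟨i, hx⟩
    simp only [weight_eq hP _ hx, one_mul, real_inner_self_eq_norm_sq]
  · filter_upwards [ae_mem_part hΩ hP] with x ⟨i, hx⟩
    simp only [weight_eq hP _ hx, real_inner_self_eq_norm_sq]
    nlinarith [mul_le_mul_of_nonneg_right (hc i) (sq_nonneg ‖(H10.grad v) x‖),
      mul_self_nonneg ((H10.fn v) x)]

theorem innerLam_bound (hΩ : IsOpen Ω) (hP : IsDomainPartition Ω P) {lam : Fin N → ℝ}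
    (hlam : lam ∈ LamPlus N) :
    ∃ C, ∀ v w : H10 Ω, ‖innerLam P lam v w‖ ≤ C * ‖v‖ * ‖w‖ := by
  have hn : ∀ v : H10 Ω, innerLam P lam v v ≤ (1 + ∑ i, |lam i|) * ‖v‖ ^ 2 := by
    intro v
    rw [sq_norm_eq, ← integral_const_mul, innerLam]
    have hi := innerLam_integrable hP (fun _ => 1) v v
    refine integral_mono_ae (innerLam_integrable hP lam v v) ?_ ?_
    · refine Integrable.const_mul (hi.congr ?_) _
      filter_upwards [ae_mem_part hΩ hP] with x ⟨i, hx⟩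
      simp only [weight_eq hP _ hx, one_mul, real_inner_self_eq_norm_sq]
    · refine Eventually.of_forall fun x => ?_
      have := (abs_le.1 (weight_abs_le P lam x)).2
      have h0 : 0 ≤ ∑ i, |lam i| := Finset.sum_nonneg fun i _ => abs_nonneg _
      simp only [real_inner_self_eq_norm_sq]
      nlinarith [mul_le_mul_of_nonneg_right this (sq_nonneg ‖(H10.grad v) x‖),
        mul_nonneg h0 (mul_self_nonneg ((H10.fn v) x)), sq_nonneg ‖(H10.grad v) x‖]
  obtain ⟨c, hc0, hc⟩ := innerLam_coercive hΩ hP hlam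
  set K := 1 + ∑ i, |lam i|
  have hK : 0 ≤ K := add_nonneg zero_le_one (Finset.sum_nonneg fun i _ => abs_nonneg _)
  refine ⟨K, fun v w => ?_⟩
  have key : ∀ s : ℝ, 0 ≤ innerLam P lam v v + 2 * s * innerLam P lam v w
      + s ^ 2 * innerLam P lam w w := by
    intro s
    have h := (mul_nonneg hc0.le (sq_nonneg ‖v + s • w‖)).trans (hc (v + s • w))
    rw [innerLam_add hP, innerLam_comm lam v, innerLam_comm lam (s • w), innerLam_add hP,
      innerLam_add hP, innerLam_smul, innerLam_smul, innerLam_comm lam v (s • w), innerLam_comm lam w (s • w),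
      innerLam_smul, innerLam_smul, innerLam_comm lam w v] at h
    linarith
  have cs : innerLam P lam v w ^ 2 ≤ innerLam P lam v v * innerLam P lam w w := by
    have := discrim_le_zero (a := innerLam P lam w w) (b := 2 * innerLam P lam v w)
      (c := innerLam P lam v v) (fun s => by nlinarith [key s])
    rw [discrim] at this
    nlinarith
  rw [Real.norm_eq_abs]
  refine abs_le_of_sq_le_sq (cs.trans ?_) (by positivity)
  have h1 := (mul_nonneg hc0.le (sq_nonneg ‖w‖)).trans (hc w)
  calc _ ≤ (K * ‖v‖ ^ 2) * (K * ‖w‖ ^ 2) := mul_le_mul (hn v) (hn w) h1 (by positivity)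
    _ = _ := by ring

theorem existsUnique_of_coercive {V : Type*} [NormedAddCommGroup V] [InnerProductSpace ℝ V]
    [CompleteSpace V] (b : V → V → ℝ) (h1 : ∀ v v' w, b (v + v') w = b v w + b v' w)
    (h2 : ∀ (a : ℝ) v w, b (a • v) w = a * b v w) (h3 : ∀ v w w', b v (w + w') = b v w + b v w')
    (h4 : ∀ (a : ℝ) v w, b v (a • w) = a * b v w) {C c : ℝ} (hC : ∀ v w, ‖b v w‖ ≤ C * ‖v‖ * ‖w‖)
    (hc0 : 0 < c) (hc : ∀ v, c * ‖v‖ ^ 2 ≤ b v v) (ℓ : V →L[ℝ] ℝ) :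
    ∃! g : V, ∀ v, b g v = ℓ v := by
  let B : V →L[ℝ] V →L[ℝ] ℝ := LinearMap.mkContinuous₂ (LinearMap.mk₂ ℝ b h1 h2 h3 h4) C hC
  have hB : IsCoercive B := ⟨c, hc0, fun v => by
    have := hc v
    rw [pow_two, ← mul_assoc] at this
    exact this⟩
  refine ⟨hB.continuousLinearEquivOfBilin.symm ((InnerProductSpace.toDual ℝ V).symm ℓ),
    fun v => ?_, fun g' hg' => ?_⟩
  · have := hB.continuousLinearEquivOfBilin_apply (hB.continuousLinearEquivOfBilin.symm
      ((InnerProductSpace.toDual ℝ V).symm ℓ)) v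
    rw [ContinuousLinearEquiv.apply_symm_apply, InnerProductSpace.toDual_symm_apply] at this
    exact this.symm
  · rw [ContinuousLinearEquiv.eq_symm_apply]
    refine ext_inner_right ℝ fun v => ?_
    rw [hB.continuousLinearEquivOfBilin_apply, InnerProductSpace.toDual_symm_apply]
    exact hg' v

/-- Well-definedness of `g(λ)` for `λ ∈ Λ⁺`. -/
theorem existsUnique_gradLam (hΩ : IsOpen Ω) (hP : IsDomainPartition Ω P) {lam : Fin N → ℝ}
    (hlam : lam ∈ LamPlus N) (e : H10 Ω → ℝ) (u : H10 Ω) :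
    ∃! g : H10 Ω, ∀ v, innerLam P lam g v = fderiv ℝ e u v := by
  obtain ⟨C, hC⟩ := innerLam_bound hΩ hP hlam
  obtain ⟨c, hc0, hc⟩ := innerLam_coercive hΩ hP hlam
  have add_right : ∀ v w w' : H10 Ω,
      innerLam P lam v (w + w') = innerLam P lam v w + innerLam P lam v w' := fun v w w' => by
    rw [innerLam_comm, innerLam_add hP, innerLam_comm lam w, innerLam_comm lam w']
  have smul_right : ∀ (a : ℝ) (v w : H10 Ω),
      innerLam P lam v (a • w) = a * innerLam P lam v w := fun a v w => by
    rw [innerLam_comm, innerLam_smul, innerLam_comm lam w]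
  exact existsUnique_of_coercive (innerLam P lam) (innerLam_add hP lam) (innerLam_smul lam)
    add_right smul_right hC hc0 hc (fderiv ℝ e u)

theorem gradLam_spec (hΩ : IsOpen Ω) (hP : IsDomainPartition Ω P) {lam : Fin N → ℝ}
    (hlam : lam ∈ LamPlus N) (e : H10 Ω → ℝ) (u v : H10 Ω) :
    innerLam P lam (gradLam P e u lam) v = fderiv ℝ e u v :=
  Classical.epsilon_spec (existsUnique_gradLam hΩ hP hlam e u).exists v

end existence

/-- `f(g) = (κ/2) e''(u; g, g) - e'(u; g)`. -/
def fCost {d : ℕ} {Ω : Set (Euc d)} (e : H10 Ω → ℝ) (u : H10 Ω) (κ : ℝ) (g : H10 Ω) : ℝ :=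
  κ / 2 * fderiv ℝ (fderiv ℝ e) u g g - fderiv ℝ e u g

/-- `j(λ) = f(g(λ))`. -/
def jCost {d N : ℕ} {Ω : Set (Euc d)} (P : Fin N → Set (Euc d)) (e : H10 Ω → ℝ) (u : H10 Ω)
    (κ : ℝ) (lam : Fin N → ℝ) : ℝ :=
  fCost e u κ (gradLam P e u lam)

/-- `x` is a minimizing sequence of `F` in `S`. -/
def IsMinimizingSeq {α : Type*} (F : α → ℝ) (S : Set α) (x : ℕ → α) : Prop :=
  (∀ k, x k ∈ S) ∧ Tendsto (fun k => (F (x k) : EReal)) atTop (𝓝 (⨅ y ∈ S, (F y : EReal)))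

/-- Weak convergence in `H = H¹₀(Ω)`. -/
def WeakTendsto {d : ℕ} {Ω : Set (Euc d)} (x : ℕ → H10 Ω) (g : H10 Ω) : Prop :=
  ∀ ℓ : H10 Ω →L[ℝ] ℝ, Tendsto (fun k => ℓ (x k)) atTop (𝓝 (ℓ g))

/-- Componentwise convergence in `[0, ∞]` of a sequence of weights. -/
def WeightTendsto {N : ℕ} (lam : ℕ → Fin N → ℝ) (l : Fin N → ℝ≥0∞) : Prop :=
  ∀ i, Tendsto (fun k => ENNReal.ofReal (lam k i)) atTop (𝓝 (l i))

/-- `Ω₀`, the union of the `Ω_i` with `λ_i = 0`. -/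
def zeroSet {d N : ℕ} (P : Fin N → Set (Euc d)) (l : Fin N → ℝ≥0∞) : Set (Euc d) :=
  ⋃ i ∈ {i | l i = 0}, P i

/-- Membership in `H¹₀(Ω; Ω_∞^const)`: `v ∈ H¹₀(Ω)` is (a.e.) constant on each `Ω_i` with
`λ_i = ∞`. -/
def ConstOnInfty {d N : ℕ} {Ω : Set (Euc d)} (P : Fin N → Set (Euc d)) (l : Fin N → ℝ≥0∞)
    (v : H10 Ω) : Prop :=
  ∀ i, l i = ⊤ → ∃ C : ℝ, ∀ᵐ x ∂(volume.restrict (P i)), (H10.fn v) x = C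

/-- `g ∈ H¹₀(Ω; Ω_∞^const)` solves
`∫_{Ω∖Ω₀} λ ∇g·∇v + g v + ∫_{Ω₀} g v = e'(u; v)` for all `v ∈ H¹₀(Ω; Ω_∞^const)`.
On `Ω_∞`, where `λ = ∞`, one has `∇g = ∇v = 0` and the term `λ ∇g·∇v` stands for `0`; this is what
the real value `0` of `ENNReal.toReal ∞` produces. -/
def IsDegenerateSolution {d N : ℕ} {Ω : Set (Euc d)} (P : Fin N → Set (Euc d)) (e : H10 Ω → ℝ)
    (u : H10 Ω) (l : Fin N → ℝ≥0∞) (g : H10 Ω) : Prop :=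
  ConstOnInfty P l g ∧ ∀ v : H10 Ω, ConstOnInfty P l v →
    (∫ x in Ω \ zeroSet P l,
        weight P (fun i => (l i).toReal) x * ⟪(H10.grad g) x, (H10.grad v) x⟫ + (H10.fn g) x * (H10.fn v) x)
      + ∫ x in zeroSet P l, (H10.fn g) x * (H10.fn v) x = fderiv ℝ e u v

end

/-!
Write `xₖ = g(λᵏ)` and decompose the form as
`(v, w)_λ = ∑ i, λᵢ ∫_{Ωᵢ} ∇v·∇w + ∫_Ω v w` (`innerLam_eq_sum`).

Coercivity of `f` makes the gradients of a minimizing sequence bounded in the separable Hilbert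
space `H¹₀(Ω)`, so a subsequence converges weakly; compactness of `[0, ∞]^N` gives a convergent
subsequence of weights. Let `xₖ ⇀ g` and `λᵏ → l`.

* Testing with `xₖ` bounds `λᵢᵏ ∫_{Ωᵢ} |∇xₖ|²`, so `∇g = 0` on `Ωᵢ` whenever `lᵢ = ∞`
  (`constOnInfty_of_weakTendsto`). As `Ωᵢ` is connected, this says that `g` is constant there
  (`constOnInfty_iff`), which is proved by mollification (`ae_const_of_weak_fderiv_eq_zero`).
* For a test function that is constant on `Ω_∞`, every term of the form passes to the limit: those
  with `lᵢ = ∞` vanish, the others are products of a convergent weight and a weakly convergent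
  integral. This is the limit equation (`isDegenerateSolution_of_weakTendsto`). Its solution is
  unique because the `L²` term of the form is definite and a Sobolev function determines its
  gradient. If `l` lies in `(0, ∞)^N`, there is no constraint and the equation is that of `g(l)`.
* Since `g` itself is admissible, testing with `xₖ - g` gives `‖xₖ - g‖_{L²} → 0`
  (`tendsto_fn_of_weakTendsto`). No compact embedding enters, so `Ω` may be unbounded.
* `f` is weakly lower semicontinuous (`quadratic_le_of_weak_limit`), hence `f(g) ≤ inf j`, which
  yields minimality in the interior case and the `liminf` inequality in the boundary case.
-/

/-! ### Constancy and vanishing gradient -/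

/-- A locally integrable function whose distributional gradient vanishes on a connected open set is
a.e. constant there.  Its mollifications `f_n` are eventually constant on each small ball, so that
`x ↦ lim f_n x` is locally constant on `U`, and this limit is `f x` for almost every `x`. -/
theorem ae_const_of_weak_fderiv_eq_zero {d : ℕ} {U : Set (Euc d)} (hU : IsOpen U)
    (hUc : IsPreconnected U) {f : Euc d → ℝ} (hf : LocallyIntegrable f volume)
    (h : ∀ φ, IsTestFunction U φ → ∀ y, ∫ x, f x * fderiv ℝ φ x y = 0) :
    ∃ C : ℝ, ∀ᵐ x ∂(volume.restrict U), f x = C := by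
  let φ : ℕ → ContDiffBump (0 : Euc d) := fun n =>
    ⟨1 / ((n : ℝ) + 1), 2 / ((n : ℝ) + 1), by positivity, by gcongr; norm_num⟩
  let F : ℕ → Euc d → ℝ := fun n =>
    MeasureTheory.convolution ((φ n).normed volume) f (ContinuousLinearMap.lsmul ℝ ℝ) volume
  have hr : Tendsto (fun n => (φ n).rOut) atTop (𝓝 0) :=
    tendsto_const_div_atTop_nhds_zero_nat 2 |>.comp (tendsto_add_atTop_nat 1) |>.congr
      fun n => by simp [φ]
  have hF : ∀ᵐ x, Tendsto (fun n => F n x) atTop (𝓝 (f x)) :=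
    ContDiffBump.ae_convolution_tendsto_right_of_locallyIntegrable (K := 2) hr
      (Eventually.of_forall fun n => by simp [φ, div_eq_mul_inv]) hf
  -- The derivative of `F n` at `x` tests `f` against a bump function centred at `x`.
  have hd : ∀ n x, Metric.closedBall x (φ n).rOut ⊆ U → HasFDerivAt (F n) (0 : Euc d →L[ℝ] ℝ) x := by
    intro n x hx
    have hc : HasCompactSupport ((φ n).normed volume) := (φ n).hasCompactSupport_normed
    have hs : ContDiff ℝ ∞ ((φ n).normed volume) := (φ n).contDiff_normed
    have hD := hc.hasFDerivAt_convolution_left (ContinuousLinearMap.lsmul ℝ ℝ)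
      (hs.of_le (by simp)) hf x
    have hi := (hc.fderiv ℝ).convolutionExists_left
      ((ContinuousLinearMap.lsmul ℝ ℝ).precompL (Euc d))
      (hs.continuous_fderiv (by simp)) hf x
    suffices H : MeasureTheory.convolution (fderiv ℝ ((φ n).normed volume)) f
        ((ContinuousLinearMap.lsmul ℝ ℝ).precompL (Euc d)) volume x = 0 by
      rwa [H] at hD
    ext y
    rw [MeasureTheory.convolution_def, ContinuousLinearMap.integral_apply hi]
    have ht : IsTestFunction U fun t => (φ n).normed volume (x - t) := by
      refine ⟨hs.comp (contDiff_const.sub contDiff_id), ?_, ?_⟩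
      · exact hc.comp_homeomorph (Homeomorph.subLeft x)
      · refine (closure_minimal ?_ Metric.isClosed_closedBall).trans hx
        intro t ht
        have : x - t ∈ Function.support ((φ n).normed volume) := ht
        rw [(φ n).support_normed_eq, Metric.mem_ball, dist_zero_right] at this
        rw [Metric.mem_closedBall, dist_comm, dist_eq_norm]
        exact this.le
    have h0 := h _ ht y
    have hfd : ∀ t, fderiv ℝ (fun t => (φ n).normed volume (x - t)) t y
        = - fderiv ℝ ((φ n).normed volume) (x - t) y := by
      intro t
      have hg := (hs.differentiable (by simp) (x - t)).hasFDerivAt.comp t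
        ((hasFDerivAt_id t).const_sub x)
      change fderiv ℝ ((φ n).normed volume ∘ fun t => x - t) t y = _
      rw [hg.fderiv]
      simp
    simp only [hfd, mul_neg, integral_neg, neg_eq_zero] at h0
    rw [← integral_sub_left_eq_self _ volume x]
    simp only [sub_sub_cancel]
    rw [_root_.zero_apply, ← h0]
    refine integral_congr_ae (Eventually.of_forall fun t => ?_)
    simp [ContinuousLinearMap.precompL_apply, mul_comm]
  -- `F n x` and `F n a` agree for large `n` when `x` is near `a`, so their `limUnder`s agree
  -- whether or not the sequences converge.
  let G : Euc d → ℝ := fun x => limUnder atTop fun n => F n x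
  have hG : ∀ a ∈ U, HasFDerivAt G (0 : Euc d →L[ℝ] ℝ) a := by
    intro a ha
    obtain ⟨r, hr0, hrU⟩ := Metric.isOpen_iff.1 hU a ha
    refine (hasFDerivAt_const (G a) a).congr_of_eventuallyEq ?_
    filter_upwards [Metric.ball_mem_nhds a (half_pos hr0)] with x hx
    have he : (fun n => F n x) =ᶠ[atTop] fun n => F n a := by
      filter_upwards [hr.eventually_lt_const (half_pos hr0)] with n hn
      have hb : ∀ z ∈ Metric.ball a (r / 2), HasFDerivAt (F n) (0 : Euc d →L[ℝ] ℝ) z := fun z hz =>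
        hd n z ((Metric.closedBall_subset_ball' (by rw [Metric.mem_ball] at hz; linarith)).trans hrU)
      exact Metric.isOpen_ball.is_const_of_fderiv_eq_zero
        (convex_ball a (r / 2)).isPreconnected
        (fun z hz => (hb z hz).differentiableAt.differentiableWithinAt)
        (fun z hz => (hb z hz).fderiv) hx (Metric.mem_ball_self (half_pos hr0))
    simp only [G, limUnder, Filter.map_congr he]
  obtain ⟨C, hC⟩ := hU.exists_is_const_of_fderiv_eq_zero hUc
    (fun z hz => (hG z hz).differentiableAt.differentiableWithinAt) (fun z hz => (hG z hz).fderiv)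
  refine ⟨C, ?_⟩
  filter_upwards [ae_restrict_of_ae hF, ae_restrict_mem hU.measurableSet] with x hx hxU
  rw [← hC x hxU]
  exact hx.limUnder_eq.symm

theorem integral_fderiv_eq_zero {d : ℕ} {φ : Euc d → ℝ} (h1 : ContDiff ℝ ∞ φ)
    (h2 : HasCompactSupport φ) (y : Euc d) : ∫ x, fderiv ℝ φ x y = 0 := by
  have hi : Integrable (fun x => fderiv ℝ φ x y) volume :=
    ((h1.continuous_fderiv (by simp)).clm_apply continuous_const).integrable_of_hasCompactSupport
      (h2.fderiv_apply ℝ y)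
  have h := integral_mul_fderiv_eq_neg_fderiv_mul_of_integrable (μ := (volume : Measure (Euc d)))
    (f := fun _ => (1 : ℝ)) (g := φ) (v := y)
    (by simp) (by simpa using hi)
    (by simpa using h1.continuous.integrable_of_hasCompactSupport h2)
    (fun x _ => differentiableAt_const _) (fun x _ => h1.differentiable (by simp) x)
  simpa using h

namespace H10

variable {d : ℕ} {Ω : Set (Euc d)}

theorem weak_gradient_of_subset (v : H10 Ω) {U : Set (Euc d)} (hUΩ : U ⊆ Ω) {φ : Euc d → ℝ}
    (hφ : IsTestFunction U φ) (y : Euc d) :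
    ∫ x in U, (fn v) x * fderiv ℝ φ x y = - ∫ x in U, ⟪(grad v) x, y⟫ * φ x := by
  have h := weak_gradient v ⟨hφ.1, hφ.2.1, hφ.2.2.trans hUΩ⟩ y
  have hz : ∀ x, x ∉ U → φ x = 0 := fun x hx =>
    image_eq_zero_of_notMem_tsupport fun h => hx (hφ.2.2 h)
  have hz' : ∀ x, x ∉ U → fderiv ℝ φ x = 0 := fun x hx =>
    image_eq_zero_of_notMem_tsupport fun h => hx (hφ.2.2 (tsupport_fderiv_subset ℝ h))
  have e1 : ∫ x in U, (fn v) x * fderiv ℝ φ x y = ∫ x in Ω, (fn v) x * fderiv ℝ φ x y := by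
    rw [setIntegral_eq_integral_of_forall_compl_eq_zero fun x hx => by simp [hz' x hx],
      setIntegral_eq_integral_of_forall_compl_eq_zero fun x hx => by simp [hz' x fun h => hx (hUΩ h)]]
  have e2 : ∫ x in U, ⟪(grad v) x, y⟫ * φ x = ∫ x in Ω, ⟪(grad v) x, y⟫ * φ x := by
    rw [setIntegral_eq_integral_of_forall_compl_eq_zero fun x hx => by simp [hz x hx],
      setIntegral_eq_integral_of_forall_compl_eq_zero fun x hx => by simp [hz x fun h => hx (hUΩ h)]]
  rw [e1, e2, h]

/-- A Sobolev function is a.e. constant on every connected open set on which its gradient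
vanishes. -/
theorem ae_const_of_grad_eq_zero (v : H10 Ω) {U : Set (Euc d)} (hU : IsOpen U)
    (hUc : IsPreconnected U) (hUΩ : U ⊆ Ω) (hv : ∀ᵐ x ∂(volume.restrict U), (grad v) x = 0) :
    ∃ C : ℝ, ∀ᵐ x ∂(volume.restrict U), (fn v) x = C := by
  have hf : LocallyIntegrable (U.indicator (fn v)) volume :=
    ((memLp_indicator_iff_restrict hU.measurableSet).2
      ((Lp.memLp (fn v)).mono_measure (Measure.restrict_mono hUΩ le_rfl))).locallyIntegrable
      (by norm_num)
  obtain ⟨C, hC⟩ := ae_const_of_weak_fderiv_eq_zero hU hUc hf fun φ hφ y => by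
    have h := weak_gradient_of_subset v hUΩ hφ y
    rw [integral_eq_zero_of_ae (f := fun x => ⟪(grad v) x, y⟫ * φ x)
      (by filter_upwards [hv] with x hx; simp [hx]), neg_zero,
      ← integral_indicator hU.measurableSet] at h
    rw [← h]
    refine integral_congr_ae (Eventually.of_forall fun x => ?_)
    by_cases hx : x ∈ U <;> simp [hx]
  refine ⟨C, ?_⟩
  filter_upwards [hC, ae_restrict_mem hU.measurableSet] with x hx hxU
  rwa [indicator_of_mem hxU] at hx

/-- The gradient of a Sobolev function vanishes a.e. on every open set on which the function is
a.e. constant. -/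
theorem grad_eq_zero_of_ae_const (v : H10 Ω) {U : Set (Euc d)} (hU : IsOpen U)
    (hUΩ : U ⊆ Ω) {C : ℝ} (hv : ∀ᵐ x ∂(volume.restrict U), (fn v) x = C) :
    ∀ᵐ x ∂(volume.restrict U), (grad v) x = 0 := by
  have hm : MemLp (grad v) 2 (volume.restrict U) :=
    (Lp.memLp (grad v)).mono_measure (Measure.restrict_mono hUΩ le_rfl)
  have hl : LocallyIntegrableOn (U.indicator (grad v)) U volume :=
    (((memLp_indicator_iff_restrict hU.measurableSet).2 hm).locallyIntegrable
      (by norm_num)).locallyIntegrableOn U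
  have key := hU.ae_eq_zero_of_integral_contDiff_smul_eq_zero hl fun φ h1 h2 h3 => by
    have hi : Integrable (fun x => φ x • (grad v) x) (volume.restrict U) :=
      (hm.locallyIntegrable (by norm_num)).integrable_smul_left_of_hasCompactSupport h1.continuous h2
    have e : ∫ x, φ x • U.indicator (grad v) x = ∫ x in U, φ x • (grad v) x := by
      rw [← integral_indicator hU.measurableSet]
      refine integral_congr_ae (Eventually.of_forall fun x => ?_)
      by_cases hx : x ∈ U <;> simp [hx]
    rw [e]
    refine ext_inner_right ℝ fun y => ?_
    rw [inner_zero_left, real_inner_comm, ← integral_inner hi]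
    have h := weak_gradient_of_subset v hUΩ ⟨h1, h2, h3⟩ y
    have h0 : ∫ x in U, (fn v) x * fderiv ℝ φ x y = 0 := by
      have hz : ∀ x, x ∉ U → fderiv ℝ φ x = 0 := fun x hx =>
        image_eq_zero_of_notMem_tsupport fun h => hx (h3 (tsupport_fderiv_subset ℝ h))
      have e' : ∫ x in U, (fn v) x * fderiv ℝ φ x y = ∫ x in U, C * fderiv ℝ φ x y := by
        refine integral_congr_ae ?_
        filter_upwards [hv] with x hx
        rw [hx]
      rw [e', integral_const_mul,
        setIntegral_eq_integral_of_forall_compl_eq_zero fun x hx => by simp [hz x hx],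
        integral_fderiv_eq_zero h1 h2 y, mul_zero]
    rw [h0, eq_comm, neg_eq_zero] at h
    rw [← h]
    refine integral_congr_ae (Eventually.of_forall fun x => ?_)
    simp only [real_inner_smul_right, real_inner_comm, mul_comm]
  rw [ae_restrict_iff' hU.measurableSet]
  filter_upwards [key] with x hx hxU
  have := hx hxU
  rwa [indicator_of_mem hxU] at this

end H10

/-! ### The Dirichlet forms on the subdomains -/

/-- Bounded sequences in a separable Hilbert space have weakly convergent subsequences. -/
theorem exists_weak_limit_of_bounded {V : Type*} [NormedAddCommGroup V] [InnerProductSpace ℝ V]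
    [CompleteSpace V] [TopologicalSpace.SeparableSpace V] {x : ℕ → V} {R : ℝ}
    (hx : ∀ k, ‖x k‖ ≤ R) : ∃ φ : ℕ → ℕ, StrictMono φ ∧ ∃ g : V, ∀ ℓ : V →L[ℝ] ℝ,
      Tendsto (fun k => ℓ (x (φ k))) atTop (𝓝 (ℓ g)) := by
  obtain ⟨a, -, φ, hφ, ha⟩ := WeakDual.isSeqCompact_closedBall ℝ V 0 R
    (x := fun k => StrongDual.toWeakDual (InnerProductSpace.toDual ℝ V (x k)))
    (fun k => by
      rw [mem_preimage, mem_closedBall_zero_iff]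
      exact ((InnerProductSpace.toDual ℝ V).norm_map (x k)).trans_le (hx k))
  refine ⟨φ, hφ, (InnerProductSpace.toDual ℝ V).symm (WeakDual.toStrongDual a), fun ℓ => ?_⟩
  have h := ((WeakDual.eval_continuous ((InnerProductSpace.toDual ℝ V).symm ℓ)).tendsto a).comp ha
  have e : ∀ g : V, ℓ g = ⟪g, (InnerProductSpace.toDual ℝ V).symm ℓ⟫ := fun g => by
    rw [real_inner_comm, InnerProductSpace.toDual_symm_apply]
  simp only [e]
  rw [InnerProductSpace.toDual_symm_apply]
  exact h

namespace H10

variable {d : ℕ} {Ω : Set (Euc d)}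

/-- `fn` as a continuous linear map `H¹₀(Ω) → L²(Ω)`. -/
noncomputable def fnL (Ω : Set (Euc d)) : H10 Ω →L[ℝ] Lp ℝ 2 (volume.restrict Ω) :=
  (WithLp.fstL 2 ℝ _ _).comp (H10 Ω).subtypeL

/-- `grad` as a continuous linear map `H¹₀(Ω) → L²(Ω; ℝᵈ)`. -/
noncomputable def gradL (Ω : Set (Euc d)) : H10 Ω →L[ℝ] Lp (Euc d) 2 (volume.restrict Ω) :=
  (WithLp.sndL 2 ℝ _ _).comp (H10 Ω).subtypeL

theorem fnL_apply (v : H10 Ω) : fnL Ω v = fn v := rfl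

theorem gradL_apply (v : H10 Ω) : gradL Ω v = grad v := rfl

theorem ext_fn_grad {v w : H10 Ω} (h1 : fn v = fn w) (h2 : grad v = grad w) : v = w := by
  rw [← sub_eq_zero, ← inner_self_eq_zero (𝕜 := ℝ), inner_eq]
  have e1 : fn (v - w) = 0 := by
    rw [← fnL_apply, map_sub, fnL_apply, fnL_apply, h1, sub_self]
  have e2 : grad (v - w) = 0 := by
    rw [← gradL_apply, map_sub, gradL_apply, gradL_apply, h2, sub_self]
  simp [e1, e2]

/-- An element of `H¹₀(Ω)` is determined by its function. -/
theorem eq_zero_of_fn_eq_zero (hΩ : IsOpen Ω) {v : H10 Ω} (h : fn v = 0) : v = 0 := by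
  have h1 : ∀ᵐ x ∂(volume.restrict Ω), (fn v) x = 0 := by
    rw [h]
    exact Lp.coeFn_zero _ _ _
  have h2 := grad_eq_zero_of_ae_const v hΩ subset_rfl h1
  refine ext_fn_grad h ((Lp.eq_zero_iff_ae_eq_zero (f := grad v)).2 h2 |>.trans ?_)
  exact (map_zero (gradL Ω)).symm

/-- The Dirichlet form `∫_U ∇v·∇w` on a subset `U` of `Ω`. -/
noncomputable def dirichlet (U : Set (Euc d)) (v w : H10 Ω) : ℝ :=
  ∫ x in U, ⟪(grad v) x, (grad w) x⟫

theorem dirichlet_comm (U : Set (Euc d)) (v w : H10 Ω) : dirichlet U v w = dirichlet U w v :=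
  integral_congr_ae (Eventually.of_forall fun _ => real_inner_comm _ _)

theorem dirichlet_self_nonneg (U : Set (Euc d)) (v : H10 Ω) : 0 ≤ dirichlet U v v :=
  integral_nonneg fun _ => real_inner_self_nonneg

/-- `v ↦ ∫_U ∇w·∇v` as a continuous linear functional (for measurable `U ⊆ Ω`). -/
theorem exists_dirichlet_eq {U : Set (Euc d)} (hU : MeasurableSet U) (hUΩ : U ⊆ Ω) (w : H10 Ω) :
    ∃ ℓ : H10 Ω →L[ℝ] ℝ, ∀ v, ℓ v = dirichlet U w v := by
  have hm : MemLp (U.indicator (grad w)) 2 (volume.restrict Ω) := (Lp.memLp (grad w)).indicator hU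
  refine ⟨(innerSL ℝ hm.toLp).comp (gradL Ω), fun v => ?_⟩
  rw [ContinuousLinearMap.comp_apply, innerSL_apply_apply, L2.inner_def, gradL_apply, dirichlet]
  have e : ∫ x in U, ⟪(grad w) x, (grad v) x⟫
      = ∫ x in Ω, U.indicator (fun x => ⟪(grad w) x, (grad v) x⟫) x := by
    rw [integral_indicator hU, Measure.restrict_restrict hU, inter_eq_left.2 hUΩ]
  rw [e]
  refine integral_congr_ae ?_
  filter_upwards [hm.coeFn_toLp] with x hx
  rw [hx]
  by_cases hxU : x ∈ U <;> simp [hxU]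

theorem dirichlet_sub_right {U : Set (Euc d)} (hU : MeasurableSet U) (hUΩ : U ⊆ Ω)
    (v w w' : H10 Ω) : dirichlet U v (w - w') = dirichlet U v w - dirichlet U v w' := by
  obtain ⟨ℓ, hℓ⟩ := exists_dirichlet_eq hU hUΩ v
  simp only [← hℓ, map_sub]

theorem dirichlet_sub_left {U : Set (Euc d)} (hU : MeasurableSet U) (hUΩ : U ⊆ Ω)
    (v v' w : H10 Ω) : dirichlet U (v - v') w = dirichlet U v w - dirichlet U v' w := by
  simp only [dirichlet_comm U _ w, dirichlet_sub_right hU hUΩ]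

theorem dirichlet_self_eq_zero_iff {U : Set (Euc d)} (hUΩ : U ⊆ Ω) (v : H10 Ω) :
    dirichlet U v v = 0 ↔ ∀ᵐ x ∂(volume.restrict U), (grad v) x = 0 := by
  have hi : Integrable (fun x => ⟪(grad v) x, (grad v) x⟫) (volume.restrict U) :=
    (L2.integrable_inner (𝕜 := ℝ) (grad v) (grad v)).mono_measure (Measure.restrict_mono hUΩ le_rfl)
  rw [dirichlet, integral_eq_zero_iff_of_nonneg (fun _ => real_inner_self_nonneg) hi]
  exact ⟨fun h => h.mono fun x hx => inner_self_eq_zero.1 hx,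
    fun h => h.mono fun x hx => inner_self_eq_zero.2 hx⟩

theorem dirichlet_eq_zero {U : Set (Euc d)} {v : H10 Ω}
    (h : ∀ᵐ x ∂(volume.restrict U), (grad v) x = 0) (w : H10 Ω) : dirichlet U v w = 0 :=
  integral_eq_zero_of_ae (h.mono fun x hx => by simp [hx])

/-- Bounded sequences in `H¹₀(Ω)` have weakly convergent subsequences. -/
theorem exists_weakTendsto {x : ℕ → H10 Ω} {R : ℝ} (hx : ∀ k, ‖x k‖ ≤ R) :
    ∃ φ : ℕ → ℕ, StrictMono φ ∧ ∃ g : H10 Ω, WeakTendsto (fun k => x (φ k)) g := by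
  have : Fact ((2 : ℝ≥0∞) ≠ ⊤) := ⟨by norm_num⟩
  have : SecondCountableTopology (Lp ℝ 2 (volume.restrict Ω)) := inferInstance
  have : SecondCountableTopology (Lp (Euc d) 2 (volume.restrict Ω)) := inferInstance
  have : SecondCountableTopology (L2Pair Ω) := WithLp.secondCountableTopology _ _ _
  have : SecondCountableTopology (H10 Ω) := TopologicalSpace.Subtype.secondCountableTopology _
  have : TopologicalSpace.SeparableSpace (H10 Ω) :=
    TopologicalSpace.SecondCountableTopology.to_separableSpace
  exact exists_weak_limit_of_bounded hx

end H10

/-! ### The weighted forms and the degenerate equation -/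

section weighted

variable {d N : ℕ} {Ω : Set (Euc d)} {P : Fin N → Set (Euc d)}

theorem innerLam_eq_sum (hP : IsDomainPartition Ω P) (lam : Fin N → ℝ) (v w : H10 Ω) :
    innerLam P lam v w = ∑ i, lam i * H10.dirichlet (P i) v w + ⟪H10.fn v, H10.fn w⟫ := by
  rw [innerLam, integral_add (weight_integrable hP lam v w) (fn_integrable v w), L2.inner_def]
  congr 1
  · simp only [weight, Finset.sum_mul]
    have hi : Integrable (fun x => ⟪(H10.grad v) x, (H10.grad w) x⟫) (volume.restrict Ω) :=
      L2.integrable_inner (𝕜 := ℝ) (H10.grad v) (H10.grad w)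
    have e : ∀ i x, (P i).indicator (fun _ => lam i) x * ⟪(H10.grad v) x, (H10.grad w) x⟫
        = (P i).indicator (fun x => lam i * ⟪(H10.grad v) x, (H10.grad w) x⟫) x := by
      intro i x
      by_cases hx : x ∈ P i <;> simp [hx]
    simp only [e]
    rw [integral_finsetSum _ fun i _ => (hi.const_mul _).indicator (hP.isOpen i).measurableSet]
    refine Finset.sum_congr rfl fun i _ => ?_
    rw [integral_indicator (hP.isOpen i).measurableSet,
      Measure.restrict_restrict (hP.isOpen i).measurableSet, inter_eq_left.2 (hP.subset i),
      integral_const_mul, H10.dirichlet]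
  · exact integral_congr_ae (Eventually.of_forall fun x => by simp [mul_comm])

theorem constOnInfty_iff (hP : IsDomainPartition Ω P) (l : Fin N → ℝ≥0∞) (v : H10 Ω) :
    ConstOnInfty P l v ↔ ∀ i, l i = ⊤ → ∀ᵐ x ∂(volume.restrict (P i)), (H10.grad v) x = 0 := by
  refine forall₂_congr fun i _ => ⟨fun ⟨C, hC⟩ => ?_, fun h => ?_⟩
  · exact H10.grad_eq_zero_of_ae_const v (hP.isOpen i) (hP.subset i) hC
  · exact H10.ae_const_of_grad_eq_zero v (hP.isOpen i) (hP.isConnected i).isPreconnected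
      (hP.subset i) h

/-- Since the weight `ENNReal.toReal ∘ l` vanishes on `Ω₀`, splitting off `Ω₀` in the degenerate
equation does not change the form. -/
theorem isDegenerateSolution_iff (hΩ : IsOpen Ω) (hP : IsDomainPartition Ω P) (e : H10 Ω → ℝ)
    (u : H10 Ω) (l : Fin N → ℝ≥0∞) (g : H10 Ω) :
    IsDegenerateSolution P e u l g ↔ ConstOnInfty P l g ∧ ∀ v : H10 Ω, ConstOnInfty P l v →
      innerLam P (fun i => (l i).toReal) g v = fderiv ℝ e u v := by
  refine and_congr_right fun _ => forall₂_congr fun v _ => ?_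
  have hZ : MeasurableSet (zeroSet P l) :=
    MeasurableSet.biUnion (Set.to_countable _) fun i _ => (hP.isOpen i).measurableSet
  have hZΩ : zeroSet P l ⊆ Ω := iUnion₂_subset fun i _ => hP.subset i
  have hi := innerLam_integrable hP (fun i => (l i).toReal) g v
  have e1 : ∫ x in zeroSet P l, (H10.fn g) x * (H10.fn v) x
      = ∫ x in zeroSet P l, weight P (fun i => (l i).toReal) x *
        ⟪(H10.grad g) x, (H10.grad v) x⟫ + (H10.fn g) x * (H10.fn v) x := by
    refine setIntegral_congr_fun hZ fun x hx => ?_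
    obtain ⟨i, hi, hx⟩ := mem_iUnion₂.1 hx
    have hi : l i = 0 := hi
    simp [weight_eq hP _ hx, hi]
  rw [e1, innerLam, add_comm, ← setIntegral_union disjoint_sdiff_right (hΩ.measurableSet.diff hZ)
    (IntegrableOn.mono_set hi hZΩ) (IntegrableOn.mono_set hi sdiff_subset),
    union_sdiff_cancel hZΩ]

theorem isDegenerateSolution_unique (hΩ : IsOpen Ω) (hP : IsDomainPartition Ω P) {e : H10 Ω → ℝ}
    {u : H10 Ω} {l : Fin N → ℝ≥0∞} {g g' : H10 Ω} (hg : IsDegenerateSolution P e u l g)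
    (hg' : IsDegenerateSolution P e u l g') : g' = g := by
  rw [isDegenerateSolution_iff hΩ hP] at hg hg'
  have hc : ConstOnInfty P l (g' - g) := fun i hi => by
    obtain ⟨C, hC⟩ := hg.1 i hi
    obtain ⟨C', hC'⟩ := hg'.1 i hi
    refine ⟨C' - C, ?_⟩
    filter_upwards [hC, hC', ae_restrict_of_ae_restrict_of_subset (hP.subset i)
      (Lp.coeFn_sub (H10.fn g') (H10.fn g))] with x h1 h2 h3
    have h3 : (H10.fn (g' - g)) x = (H10.fn g') x - (H10.fn g) x := h3
    rw [h3, h1, h2]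
  have h := (hg'.2 _ hc).trans (hg.2 _ hc).symm
  have h0 : innerLam P (fun i => (l i).toReal) (g' - g) (g' - g) = 0 := by
    have := innerLam_add hP (fun i => (l i).toReal) (g' - g) g (g' - g)
    rw [sub_add_cancel] at this
    linarith
  rw [innerLam_eq_sum hP] at h0
  have hs : 0 ≤ ∑ i, (l i).toReal * H10.dirichlet (P i) (g' - g) (g' - g) :=
    Finset.sum_nonneg fun i _ => mul_nonneg ENNReal.toReal_nonneg (H10.dirichlet_self_nonneg _ _)
  have h1 : ⟪H10.fn (g' - g), H10.fn (g' - g)⟫ = 0 :=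
    le_antisymm (by linarith) real_inner_self_nonneg
  exact sub_eq_zero.1 (H10.eq_zero_of_fn_eq_zero hΩ (inner_self_eq_zero.1 h1))

end weighted

/-! ### Passing to the limit -/

section limits

variable {d N : ℕ} {Ω : Set (Euc d)} {P : Fin N → Set (Euc d)}

theorem WeightTendsto.exists_subseq {N : ℕ} (lam : ℕ → Fin N → ℝ) :
    ∃ ψ : ℕ → ℕ, StrictMono ψ ∧ ∃ l : Fin N → ℝ≥0∞, WeightTendsto (fun k => lam (ψ k)) l := by
  obtain ⟨l, ψ, hψ, h⟩ := CompactSpace.tendsto_subseq fun k i => ENNReal.ofReal (lam k i)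
  exact ⟨ψ, hψ, l, fun i => (tendsto_pi_nhds.1 h) i⟩

theorem WeightTendsto.tendsto_toReal {lam : ℕ → Fin N → ℝ} {l : Fin N → ℝ≥0∞}
    (h : WeightTendsto lam l) (hlam : ∀ k, lam k ∈ LamPlus N) {i : Fin N} (hi : l i ≠ ⊤) :
    Tendsto (fun k => lam k i) atTop (𝓝 (l i).toReal) :=
  ((ENNReal.tendsto_toReal hi).comp (h i)).congr fun k => ENNReal.toReal_ofReal (hlam k i).le

theorem WeightTendsto.tendsto_atTop {lam : ℕ → Fin N → ℝ} {l : Fin N → ℝ≥0∞}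
    (h : WeightTendsto lam l) {i : Fin N} (hi : l i = ⊤) :
    Tendsto (fun k => lam k i) atTop atTop :=
  ENNReal.tendsto_ofReal_nhds_top.1 (hi ▸ h i)

theorem WeakTendsto.tendsto_dirichlet (hP : IsDomainPartition Ω P) {x : ℕ → H10 Ω} {g : H10 Ω}
    (hx : WeakTendsto x g) (i : Fin N) (w : H10 Ω) :
    Tendsto (fun k => H10.dirichlet (P i) w (x k)) atTop (𝓝 (H10.dirichlet (P i) w g)) := by
  obtain ⟨ℓ, hℓ⟩ := H10.exists_dirichlet_eq (hP.isOpen i).measurableSet (hP.subset i) w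
  simpa only [hℓ] using hx ℓ

theorem WeakTendsto.tendsto_inner_fn {x : ℕ → H10 Ω} {g : H10 Ω}
    (hx : WeakTendsto x g) (w : H10 Ω) :
    Tendsto (fun k => ⟪H10.fn w, H10.fn (x k)⟫) atTop (𝓝 ⟪H10.fn w, H10.fn g⟫) :=
  hx ((innerSL ℝ (H10.fn w)).comp (H10.fnL Ω))

/-- The energy bound `λᵢᵏ ∫_{Ωᵢ} |∇xₖ|² ≤ ℓ(xₖ)` forces the gradient of the weak limit to vanish
where `λᵢᵏ → ∞`. -/
theorem constOnInfty_of_weakTendsto (hP : IsDomainPartition Ω P)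
    {lam : ℕ → Fin N → ℝ} (hlam : ∀ k, lam k ∈ LamPlus N) {l : Fin N → ℝ≥0∞}
    (hl : WeightTendsto lam l) {x : ℕ → H10 Ω} {g : H10 Ω} (hx : WeakTendsto x g)
    {ℓ : H10 Ω →L[ℝ] ℝ} (hℓ : ∀ k v, innerLam P (lam k) (x k) v = ℓ v) :
    ConstOnInfty P l g := by
  rw [constOnInfty_iff hP]
  intro i hi
  have hU := (hP.isOpen i).measurableSet
  rw [← H10.dirichlet_self_eq_zero_iff (hP.subset i)]
  refine le_antisymm ?_ (H10.dirichlet_self_nonneg _ _)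
  have hle : ∀ k, 2 * H10.dirichlet (P i) g (x k) - H10.dirichlet (P i) g g
      ≤ ℓ (x k) / lam k i := by
    intro k
    have h1 := H10.dirichlet_self_nonneg (P i) (x k - g)
    simp only [H10.dirichlet_sub_left hU (hP.subset i), H10.dirichlet_sub_right hU (hP.subset i),
      H10.dirichlet_comm _ (x k) g] at h1
    have h2 : lam k i * H10.dirichlet (P i) (x k) (x k) ≤ ℓ (x k) := by
      rw [← hℓ k, innerLam_eq_sum hP]
      have := Finset.single_le_sum (s := Finset.univ)
        (f := fun i => lam k i * H10.dirichlet (P i) (x k) (x k))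
        (fun j _ => mul_nonneg (hlam k j).le (H10.dirichlet_self_nonneg _ _)) (Finset.mem_univ i)
      have h3 : 0 ≤ ⟪H10.fn (x k), H10.fn (x k)⟫ := real_inner_self_nonneg
      linarith
    rw [mul_comm, ← le_div_iff₀ (hlam k i)] at h2
    linarith
  have hl1 := ((hx.tendsto_dirichlet hP i g).const_mul 2).sub_const (H10.dirichlet (P i) g g)
  have h := le_of_tendsto_of_tendsto' hl1 ((hx ℓ).div_atTop (hl.tendsto_atTop hi)) hle
  linarith

/-- Each term of the weighted Dirichlet form passes to the limit when tested with a function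
that is constant on `Ω_∞`: there the term vanishes identically. -/
theorem tendsto_mul_dirichlet (hP : IsDomainPartition Ω P)
    {lam : ℕ → Fin N → ℝ} (hlam : ∀ k, lam k ∈ LamPlus N) {l : Fin N → ℝ≥0∞}
    (hl : WeightTendsto lam l) {x : ℕ → H10 Ω} {g : H10 Ω} (hx : WeakTendsto x g)
    {w : H10 Ω} (hw : ConstOnInfty P l w) (i : Fin N) :
    Tendsto (fun k => lam k i * H10.dirichlet (P i) w (x k)) atTop
      (𝓝 ((l i).toReal * H10.dirichlet (P i) w g)) := by
  by_cases hi : l i = ⊤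
  · simp [H10.dirichlet_eq_zero ((constOnInfty_iff hP l w).1 hw i hi)]
  · exact (hl.tendsto_toReal hlam hi).mul (hx.tendsto_dirichlet hP i w)

theorem isDegenerateSolution_of_weakTendsto (hΩ : IsOpen Ω) (hP : IsDomainPartition Ω P)
    {lam : ℕ → Fin N → ℝ} (hlam : ∀ k, lam k ∈ LamPlus N) {l : Fin N → ℝ≥0∞}
    (hl : WeightTendsto lam l) {x : ℕ → H10 Ω} {g : H10 Ω} (hx : WeakTendsto x g)
    {e : H10 Ω → ℝ} {u : H10 Ω} (he : ∀ k v, innerLam P (lam k) (x k) v = fderiv ℝ e u v) :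
    IsDegenerateSolution P e u l g := by
  rw [isDegenerateSolution_iff hΩ hP]
  refine ⟨constOnInfty_of_weakTendsto hP hlam hl hx he, fun v hv => ?_⟩
  have h := (tendsto_finsetSum Finset.univ fun i _ =>
    tendsto_mul_dirichlet hP hlam hl hx hv i).add (hx.tendsto_inner_fn v)
  simp only [← innerLam_eq_sum hP] at h
  simp only [innerLam_comm _ v, he] at h
  exact tendsto_nhds_unique h tendsto_const_nhds

/-- Strong convergence in `L²(Ω)`, obtained without any compact embedding: test the equation with
`xₖ - g` and use `∇g = 0` on `Ω_∞`. -/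
theorem tendsto_fn_of_weakTendsto (hP : IsDomainPartition Ω P)
    {lam : ℕ → Fin N → ℝ} (hlam : ∀ k, lam k ∈ LamPlus N) {l : Fin N → ℝ≥0∞}
    (hl : WeightTendsto lam l) {x : ℕ → H10 Ω} {g : H10 Ω} (hx : WeakTendsto x g)
    {ℓ : H10 Ω →L[ℝ] ℝ} (hℓ : ∀ k v, innerLam P (lam k) (x k) v = ℓ v) :
    Tendsto (fun k => H10.fn (x k)) atTop (𝓝 (H10.fn g)) := by
  have hg := constOnInfty_of_weakTendsto hP hlam hl hx hℓ
  have hx0 : WeakTendsto (fun k => x k - g) 0 := fun ℓ' => by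
    simpa using (hx ℓ').sub_const (ℓ' g)
  have hlim : Tendsto (fun k => ℓ (x k - g) - (∑ i, lam k i * H10.dirichlet (P i) g (x k - g)
      + ⟪H10.fn g, H10.fn (x k - g)⟫)) atTop (𝓝 0) := by
    have h := (hx0 ℓ).sub ((tendsto_finsetSum Finset.univ fun i _ =>
      tendsto_mul_dirichlet hP hlam hl hx0 hg i).add (hx0.tendsto_inner_fn g))
    simp only [← innerLam_eq_sum hP] at h ⊢
    have z : innerLam P (fun i => (l i).toReal) g 0 = 0 := by
      have := innerLam_smul (P := P) (fun i => (l i).toReal) 0 0 g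
      rwa [zero_smul, zero_mul, innerLam_comm] at this
    rwa [z, map_zero, sub_zero] at h
  have hle : ∀ k, ‖H10.fn (x k) - H10.fn g‖ ^ 2 ≤
      ℓ (x k - g) - (∑ i, lam k i * H10.dirichlet (P i) g (x k - g)
        + ⟪H10.fn g, H10.fn (x k - g)⟫) := by
    intro k
    rw [← hℓ k, ← innerLam_eq_sum hP]
    have h := innerLam_add hP (lam k) (x k - g) g (x k - g)
    rw [sub_add_cancel] at h
    rw [h, add_sub_cancel_right, innerLam_eq_sum hP, ← real_inner_self_eq_norm_sq]
    have h1 : ∀ i ∈ Finset.univ, 0 ≤ lam k i * H10.dirichlet (P i) (x k - g) (x k - g) :=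
      fun i _ => mul_nonneg (hlam k i).le (H10.dirichlet_self_nonneg _ _)
    exact le_add_of_nonneg_left (Finset.sum_nonneg h1)
  have h2 := (squeeze_zero (fun k => sq_nonneg _) hle hlim).sqrt
  rw [tendsto_iff_norm_sub_tendsto_zero]
  simpa [Real.sqrt_sq] using h2

end limits

/-! ### The cost functional -/

section cost

variable {d N : ℕ} {Ω : Set (Euc d)}

/-- A quadratic functional with nonnegative quadratic part is weakly sequentially lower
semicontinuous: it lies above its affine tangent at `g`, which is weakly continuous. -/
theorem quadratic_le_of_weak_limit {V : Type*} [NormedAddCommGroup V] [NormedSpace ℝ V]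
    {B : V →L[ℝ] V →L[ℝ] ℝ} (hB : ∀ v, 0 ≤ B v v) (ℓ : V →L[ℝ] ℝ) {c : ℝ} (hc : 0 ≤ c)
    {x : ℕ → V} {g : V} (hx : ∀ ℓ' : V →L[ℝ] ℝ, Tendsto (fun k => ℓ' (x k)) atTop (𝓝 (ℓ' g)))
    {I : EReal} (hI : Tendsto (fun k => ((c * B (x k) (x k) - ℓ (x k) : ℝ) : EReal)) atTop (𝓝 I)) :
    ((c * B g g - ℓ g : ℝ) : EReal) ≤ I := by
  have hlim : Tendsto (fun k => c * (B g (x k) + B.flip g (x k) - B g g) - ℓ (x k))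
      atTop (𝓝 (c * (B g g + B.flip g g - B g g) - ℓ g)) :=
    ((((hx (B g)).add (hx (B.flip g))).sub_const (B g g)).const_mul c).sub (hx ℓ)
  rw [ContinuousLinearMap.flip_apply, add_sub_cancel_right] at hlim
  refine le_of_tendsto_of_tendsto' (EReal.tendsto_coe.2 hlim) hI fun k => ?_
  rw [EReal.coe_le_coe_iff, ContinuousLinearMap.flip_apply]
  have h := hB (x k - g)
  simp only [map_sub, _root_.sub_apply] at h
  have := mul_le_mul_of_nonneg_left
    (show B g (x k) + B (x k) g - B g g ≤ B (x k) (x k) by linarith) hc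
  linarith

/-- Sublevel sets of `f` are bounded. -/
theorem exists_norm_le_of_fCost_le {e : H10 Ω → ℝ} {u : H10 Ω} {κ m : ℝ} (hm : 0 < m)
    (hκ : 0 < κ) (hell : ∀ v : H10 Ω, m * ‖v‖ ^ 2 ≤ fderiv ℝ (fderiv ℝ e) u v v) (b : ℝ) :
    ∃ R, ∀ g : H10 Ω, fCost e u κ g ≤ b → ‖g‖ ≤ R := by
  have hc : 0 < κ / 2 * m := by positivity
  refine ⟨max 1 ((|b| + ‖fderiv ℝ e u‖) / (κ / 2 * m)), fun g hg => ?_⟩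
  by_contra! h
  obtain ⟨h1, h2⟩ := max_lt_iff.1 h
  rw [div_lt_iff₀ hc] at h2
  have h3 := (le_abs_self _).trans ((fderiv ℝ e u).le_opNorm g)
  have h4 := mul_le_mul_of_nonneg_left (hell g) (by positivity : 0 ≤ κ / 2)
  have h5 := mul_lt_mul_of_pos_right h2 (one_pos.trans h1)
  have h6 := mul_le_mul_of_nonneg_left h1.le (abs_nonneg b)
  rw [fCost] at hg
  nlinarith [le_abs_self b]

theorem IsMinimizingSeq.exists_le {α : Type*} {F : α → ℝ} {S : Set α} {x : ℕ → α}
    (hx : IsMinimizingSeq F S x) : ∃ b, ∀ k, F (x k) ≤ b := by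
  have h1 : (⨅ y ∈ S, (F y : EReal)) < ((F (x 0) + 1 : ℝ) : EReal) :=
    (iInf₂_le (x 0) (hx.1 0)).trans_lt (EReal.coe_lt_coe_iff.2 (lt_add_one _))
  have h2 : ∀ᶠ k in atTop, F (x k) ≤ F (x 0) + 1 :=
    (hx.2.eventually_lt_const h1).mono fun k hk => (EReal.coe_lt_coe_iff.1 hk).le
  obtain ⟨b, hb⟩ := (isBoundedUnder_of_eventually_le h2).bddAbove_range
  exact ⟨b, fun k => hb (mem_range_self k)⟩

end cost

theorem propositionp (d : ℕ) (hd : 1 ≤ d) (Ω : Set (Euc d)) (hΩ : IsOpen Ω)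
    (N : ℕ) (P : Fin N → Set (Euc d)) (hP : IsDomainPartition Ω P)
    (e : H10 Ω → ℝ) (he : ContDiff ℝ 2 e)
    (M m : ℝ) (hM : 0 < M) (hm : 0 < m)
    (hbound : ∀ u v w : H10 Ω, |fderiv ℝ (fderiv ℝ e) u v w| ≤ M * ‖v‖ * ‖w‖)
    (hell : ∀ u v : H10 Ω, m * ‖v‖ ^ 2 ≤ fderiv ℝ (fderiv ℝ e) u v v)
    (u : H10 Ω) (κ : ℝ) (hκ : 0 < κ)
    (lam : ℕ → Fin N → ℝ) (hlam : IsMinimizingSeq (jCost P e u κ) (LamPlus N) lam) :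
    -- a subsequence of the gradients converges weakly in `H¹₀(Ω)` and strongly in `L²(Ω)`
    (∃ φ : ℕ → ℕ, StrictMono φ ∧ ∃ g : H10 Ω,
      WeakTendsto (fun k => gradLam P e u (lam (φ k))) g ∧
      Tendsto (fun k => H10.fn (gradLam P e u (lam (φ k)))) atTop (𝓝 (H10.fn g))) ∧
    -- for every such subsequence and limit `g`
    ∀ φ : ℕ → ℕ, StrictMono φ → ∀ g : H10 Ω,
      WeakTendsto (fun k => gradLam P e u (lam (φ k))) g →
      -- a further subsequence of the weights converges in `[0, ∞]^N`
      (∃ ψ : ℕ → ℕ, StrictMono ψ ∧ ∃ l : Fin N → ℝ≥0∞,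
        WeightTendsto (fun k => lam (φ (ψ k))) l) ∧
      -- and whenever one converges, one of the cases (i), (ii) takes place
      ∀ ψ : ℕ → ℕ, StrictMono ψ → ∀ l : Fin N → ℝ≥0∞,
        WeightTendsto (fun k => lam (φ (ψ k))) l →
        (∃ lhat : Fin N → ℝ, lhat ∈ LamPlus N ∧ (∀ i, l i = ENNReal.ofReal (lhat i)) ∧
          (∀ i, Tendsto (fun k => lam (φ (ψ k)) i) atTop (𝓝 (lhat i))) ∧
          g = gradLam P e u lhat ∧
          (∀ v : H10 Ω, innerLam P lhat g v = fderiv ℝ e u v) ∧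
          IsMinOn (jCost P e u κ) (LamPlus N) lhat) ∨
        (l ∈ LamBoundary N ∧
          IsDegenerateSolution P e u l g ∧
          (∀ g' : H10 Ω, IsDegenerateSolution P e u l g' → g' = g) ∧
          (fCost e u κ g : EReal) ≤
            liminf (fun k => (jCost P e u κ (lam k) : EReal)) atTop) := by
  have hsol : ∀ k v, innerLam P (lam k) (gradLam P e u (lam k)) v = fderiv ℝ e u v :=
    fun k v => gradLam_spec hΩ hP (hlam.1 k) e u v
  constructor
  · obtain ⟨b, hb⟩ := hlam.exists_le
    obtain ⟨R, hR⟩ := exists_norm_le_of_fCost_le hm hκ (hell u) b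
    obtain ⟨φ, hφ, g, hg⟩ := H10.exists_weakTendsto fun k => hR _ (hb k)
    obtain ⟨ψ, hψ, l, hl⟩ := WeightTendsto.exists_subseq fun k => lam (φ k)
    have hg' : WeakTendsto (fun k => gradLam P e u (lam (φ (ψ k)))) g :=
      fun ℓ => (hg ℓ).comp hψ.tendsto_atTop
    exact ⟨φ ∘ ψ, hφ.comp hψ, g, hg',
      tendsto_fn_of_weakTendsto hP (fun k => hlam.1 _) hl hg' fun k => hsol _⟩
  · intro φ hφ g hg
    refine ⟨WeightTendsto.exists_subseq fun k => lam (φ k), fun ψ hψ l hl => ?_⟩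
    have hg' : WeakTendsto (fun k => gradLam P e u (lam (φ (ψ k)))) g :=
      fun ℓ => (hg ℓ).comp hψ.tendsto_atTop
    have hdeg : IsDegenerateSolution P e u l g :=
      isDegenerateSolution_of_weakTendsto hΩ hP (fun k => hlam.1 _) hl hg' fun k => hsol _
    have hle : (fCost e u κ g : EReal) ≤ ⨅ y ∈ LamPlus N, (jCost P e u κ y : EReal) :=
      quadratic_le_of_weak_limit (fun v => (by positivity : 0 ≤ m * ‖v‖ ^ 2).trans (hell u v)) _
        (by positivity) hg'
        (hlam.2.comp (hφ.comp hψ).tendsto_atTop)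
    by_cases hb : l ∈ LamBoundary N
    · exact Or.inr ⟨hb, hdeg, fun g' => isDegenerateSolution_unique hΩ hP hdeg,
        hle.trans hlam.2.liminf_eq.ge⟩
    · have hb' : ∀ i, l i ≠ 0 ∧ l i ≠ ⊤ := fun i => by
        simpa [LamBoundary, not_or] using fun h => hb ⟨i, h⟩
      have hpos : (fun i => (l i).toReal) ∈ LamPlus N :=
        fun i => ENNReal.toReal_pos (hb' i).1 (hb' i).2
      have heq := fun v => ((isDegenerateSolution_iff hΩ hP e u l g).1 hdeg).2 v
        fun i hi => absurd hi (hb' i).2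
      have hgl : g = gradLam P e u fun i => (l i).toReal :=
        (existsUnique_gradLam hΩ hP hpos e u).unique heq (gradLam_spec hΩ hP hpos e u)
      refine Or.inl ⟨_, hpos, fun i => (ENNReal.ofReal_toReal (hb' i).2).symm,
        fun i => hl.tendsto_toReal (fun k => hlam.1 _) (hb' i).2, hgl, heq, fun y hy => ?_⟩
      change fCost e u κ _ ≤ _
      rw [← hgl]
      exact EReal.coe_le_coe_iff.1 (hle.trans (iInf₂_le y hy))
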